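/- Let $n\ge 1$ and let $k_1,\dots,k_n\ge 2$ be integers. Let $\Gamma_1$ be the graph obtained by gluing $n$ cycles, the $j$-th one having $k_j+1$ vertices, at one common vertex (the root), and let $\Gamma$ be obtained from $\Gamma_1$ by joining the root by a new edge to the first vertex of a one-sided infinite path. Let $A(\Gamma)$ be the adjacency operator of $\Gamma$ on $\ell^2$ of the vertex set, and let the discrete spectrum $\sigma_d(\Gamma)$ be the set of eigenvalues of $A(\Gamma)$ of finite multiplicity lying off $[-2,2]$. Then the equation $$2\sum_{j=1}^n\frac{\sinh (k_jt)+\sinh t}{\sinh((k_j+1)t)}=e^t,\qquad t>0,$$ has a unique solution $t_+$, and $\lambda_+:=2\cosh t_+\in\sigma_d(\Gamma)$. If, moreover, $\Gamma_1$ is not a single triangle (that is, unless $n=1$ and $k_1=2$), then the equation $$2\sum_{j=1}^n\frac{\sinh (k_jt)+(-1)^{k_j+1}\sinh t}{\sinh((k_j+1)t)}=e^t,\qquad t>0,$$ has a unique solution $t_-$, and with $\lambda_-:=-2\cosh t_-$ one has $$\sigma_d(\Gamma)=\{\lambda_+,\lambda_-\}.$$ -/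

import Mathlib

noncomputable section

namespace FlowerGraph

/-! ### Adjacency operator of a uniformly locally finite graph -/

/-- The complex Hilbert space `ℓ²(V)`. -/
abbrev EllTwo (V : Type*) : Type _ := lp (fun _ : V => ℂ) 2

/-- The degrees of the vertices are finite and uniformly bounded. -/
def UniformlyLocallyFinite {V : Type*} (G : SimpleGraph V) : Prop :=
  ∃ d : ℕ, ∀ v, (G.neighborSet v).encard ≤ d

/-- The action of the adjacency matrix on a function: `(A f)(v) = ∑_{w ∼ v} f(w)`. -/
def adjFun {V : Type*} (G : SimpleGraph V) (f : V → ℂ) (v : V) : ℂ :=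
  ∑ᶠ w ∈ G.neighborSet v, f w

theorem neighborSet_finite {V : Type*} {G : SimpleGraph V} (hG : UniformlyLocallyFinite G)
    (v : V) : (G.neighborSet v).Finite := by
  obtain ⟨d, hd⟩ := hG
  exact Set.finite_of_encard_le_coe (hd v)

theorem adjFun_eq_sum {V : Type*} {G : SimpleGraph V} (hG : UniformlyLocallyFinite G)
    (f : V → ℂ) (v : V) :
    adjFun G f v = ∑ w ∈ (neighborSet_finite hG v).toFinset, f w :=
  finsum_mem_eq_finite_toFinset_sum _ _

theorem sum_adjFun_le {V : Type*} {G : SimpleGraph V} (hG : UniformlyLocallyFinite G)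
    {d : ℕ} (hd : ∀ v, (G.neighborSet v).encard ≤ d) (f : EllTwo V) (s : Finset V) :
    ∑ v ∈ s, ‖adjFun G f v‖ ^ (2 : ENNReal).toReal ≤ (d * ‖f‖) ^ (2 : ENNReal).toReal := by
  classical
  set N : V → Finset V := fun v => (neighborSet_finite hG v).toFinset with hN
  have hmem : ∀ v w, w ∈ N v ↔ G.Adj v w := fun v w => by simp [hN]
  have hcard : ∀ v, ((N v).card : ℝ) ≤ d := fun v => by
    have h := hd v
    rw [(neighborSet_finite hG v).encard_eq_coe_toFinset_card] at h
    exact_mod_cast h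
  have hf : ∀ t : Finset V, ∑ w ∈ t, ‖f w‖ ^ 2 ≤ ‖f‖ ^ 2 := fun t => by
    simpa using lp.sum_rpow_le_norm_rpow (p := 2) (by simp) f t
  have h1 : ∀ v, ‖adjFun G f v‖ ^ 2 ≤ d * ∑ w ∈ N v, ‖f w‖ ^ 2 := fun v => by
    rw [adjFun_eq_sum hG]
    calc ‖∑ w ∈ N v, f w‖ ^ 2 ≤ (∑ w ∈ N v, ‖f w‖) ^ 2 := by
          gcongr
          exact norm_sum_le _ _
      _ ≤ (N v).card * ∑ w ∈ N v, ‖f w‖ ^ 2 := sq_sum_le_card_mul_sum_sq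
      _ ≤ d * ∑ w ∈ N v, ‖f w‖ ^ 2 := by
          gcongr
          exact_mod_cast hcard v
  have h2 : ∑ v ∈ s, ∑ w ∈ N v, ‖f w‖ ^ 2 ≤ d * ‖f‖ ^ 2 := by
    calc ∑ v ∈ s, ∑ w ∈ N v, ‖f w‖ ^ 2
        = ∑ w ∈ s.biUnion N, ∑ v ∈ s with w ∈ N v, ‖f w‖ ^ 2 := by
          apply Finset.sum_comm'
          intro v w
          simp only [Finset.mem_biUnion, Finset.mem_filter]
          constructor
          · rintro ⟨a, b⟩
            exact ⟨⟨a, b⟩, v, a, b⟩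
          · rintro ⟨a, -⟩
            exact a
      _ ≤ ∑ w ∈ s.biUnion N, d * ‖f w‖ ^ 2 := by
          apply Finset.sum_le_sum
          intro w _
          rw [Finset.sum_const, nsmul_eq_mul]
          gcongr
          refine le_trans ?_ (show (N w).card ≤ d by exact_mod_cast hcard w)
          apply Finset.card_le_card
          intro v hv
          rw [Finset.mem_filter, hmem] at hv
          rw [hmem]
          exact hv.2.symm
      _ = d * ∑ w ∈ s.biUnion N, ‖f w‖ ^ 2 := by rw [Finset.mul_sum]
      _ ≤ d * ‖f‖ ^ 2 := by
          gcongr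
          exact hf _
  simp only [ENNReal.toReal_ofNat, Real.rpow_ofNat]
  calc ∑ v ∈ s, ‖adjFun G f v‖ ^ 2 ≤ ∑ v ∈ s, d * ∑ w ∈ N v, ‖f w‖ ^ 2 :=
        Finset.sum_le_sum fun v _ => h1 v
    _ = d * ∑ v ∈ s, ∑ w ∈ N v, ‖f w‖ ^ 2 := by rw [Finset.mul_sum]
    _ ≤ d * (d * ‖f‖ ^ 2) := by gcongr
    _ = (d * ‖f‖) ^ 2 := by ring

theorem memℓp_adjFun {V : Type*} {G : SimpleGraph V} (hG : UniformlyLocallyFinite G)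
    (f : EllTwo V) : Memℓp (fun v => adjFun G f v) 2 := by
  obtain ⟨d, hd⟩ := id hG
  exact memℓp_gen' (sum_adjFun_le hG hd f)

/-- The adjacency operator, as a bounded operator on `ℓ²(V)`. -/
def adjacencyOperator {V : Type*} (G : SimpleGraph V) (hG : UniformlyLocallyFinite G) :
    EllTwo V →L[ℂ] EllTwo V :=
  LinearMap.mkContinuousOfExistsBound
    { toFun := fun f => ⟨fun v => adjFun G f v, memℓp_adjFun hG f⟩
      map_add' := fun f g => by
        ext v
        change adjFun G (fun w => f w + g w) v = adjFun G f v + adjFun G g v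
        simp only [adjFun_eq_sum hG, Finset.sum_add_distrib]
      map_smul' := fun c f => by
        ext v
        change adjFun G (fun w => c * f w) v = c * adjFun G f v
        simp only [adjFun_eq_sum hG, Finset.mul_sum] }
    (by
      obtain ⟨d, hd⟩ := id hG
      exact ⟨d, fun f => lp.norm_le_of_forall_sum_le (by simp) (by positivity)
        (sum_adjFun_le hG hd f)⟩)

theorem adjacencyOperator_apply {V : Type*} (G : SimpleGraph V)
    (hG : UniformlyLocallyFinite G) (f : EllTwo V) (v : V) :
    adjacencyOperator G hG f v = ∑ᶠ w ∈ G.neighborSet v, f w := rfl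

/-- For a finite graph with a ray attached, whose essential spectrum is `[-2, 2]`, the discrete
spectrum is the set of eigenvalues of finite multiplicity off `[-2, 2]`. -/
def discreteSpectrum {V : Type*} (T : EllTwo V →L[ℂ] EllTwo V) : Set ℂ :=
  {l | Module.End.HasEigenvalue (T : EllTwo V →ₗ[ℂ] EllTwo V) l ∧
    FiniteDimensional ℂ (Module.End.eigenspace (T : EllTwo V →ₗ[ℂ] EllTwo V) l) ∧
    l ∉ (fun x : ℝ => (x : ℂ)) '' Set.Icc (-2) 2}

/-! ### The flower with a ray attached to its root -/

/-- The coupling of two graphs by means of the bridge `{v, w}`. -/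
def coupling {V W : Type*} (G : SimpleGraph V) (H : SimpleGraph W) (v : V) (w : W) :
    SimpleGraph (V ⊕ W) :=
  (G ⊕g H) ⊔ SimpleGraph.edge (Sum.inl v) (Sum.inr w)

/-- The one-sided infinite path `0 - 1 - 2 - ⋯`. -/
def ray : SimpleGraph ℕ := SimpleGraph.hasse ℕ

/-- Vertices of the flower: the root `none`, and for every `j` the `k j` vertices of the `j`-th
cycle other than the root. -/
abbrev FlowerVertex {n : ℕ} (k : Fin n → ℕ) : Type := Option (Σ j : Fin n, Fin (k j))

/-- The `j`-th cycle, with vertices `0, …, k j`, inside the flower; `0` goes to the root. -/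
def petal {n : ℕ} (k : Fin n → ℕ) (j : Fin n) : Fin (k j + 1) ↪ FlowerVertex k where
  toFun := Fin.cases none (fun i => some ⟨j, i⟩)
  inj' := by
    intro a b
    refine Fin.cases ?_ (fun a => ?_) a <;> refine Fin.cases ?_ (fun b => ?_) b <;> simp

/-- `n` cycles, the `j`-th one with `k j + 1` vertices, glued together at one common vertex. -/
def flower {n : ℕ} (k : Fin n → ℕ) : SimpleGraph (FlowerVertex k) :=
  ⨆ j : Fin n, (SimpleGraph.cycleGraph (k j + 1)).map (petal k j)

/-- The flower with the infinite path attached to its root. -/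
def flowerWithRay {n : ℕ} (k : Fin n → ℕ) : SimpleGraph (FlowerVertex k ⊕ ℕ) :=
  coupling (flower k) ray none 0

theorem uniformlyLocallyFinite_of_finite {V : Type*} [Finite V] (G : SimpleGraph V) :
    UniformlyLocallyFinite G := by
  refine ⟨Nat.card V, fun v => ?_⟩
  rw [← ENat.card_eq_coe_natCard V, ← Set.encard_univ V]
  exact Set.encard_le_encard (Set.subset_univ _)

theorem uniformlyLocallyFinite_ray : UniformlyLocallyFinite ray := by
  refine ⟨2, fun v => ?_⟩
  refine le_trans (Set.encard_le_encard (t := {v + 1, v - 1}) ?_)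
    ((Set.encard_insert_le _ _).trans (by rw [Set.encard_singleton]; norm_num))
  intro w hw
  simp only [ray, SimpleGraph.mem_neighborSet, SimpleGraph.hasse_adj, Nat.covBy_iff_add_one_eq]
    at hw
  simp only [Set.mem_insert_iff, Set.mem_singleton_iff]
  omega

theorem uniformlyLocallyFinite_coupling {V W : Type*} {G : SimpleGraph V} {H : SimpleGraph W}
    (hG : UniformlyLocallyFinite G) (hH : UniformlyLocallyFinite H) (v : V) (w : W) :
    UniformlyLocallyFinite (coupling G H v w) := by
  obtain ⟨a, ha⟩ := hG
  obtain ⟨b, hb⟩ := hH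
  refine ⟨a + b + 1, ?_⟩
  rintro (x | x)
  · have hsub : (coupling G H v w).neighborSet (Sum.inl x) ⊆
        (Sum.inl '' G.neighborSet x) ∪ {Sum.inr w} := by
      rintro (y | y) hy <;>
        simp_all [coupling, SimpleGraph.edge_adj]
    calc _ ≤ _ := Set.encard_le_encard hsub
      _ ≤ (Sum.inl '' G.neighborSet x : Set (V ⊕ W)).encard + 1 := by
          simpa using Set.encard_union_le (Sum.inl '' G.neighborSet x : Set (V ⊕ W)) {Sum.inr w}
      _ ≤ (a : ℕ∞) + 1 := by
          gcongr
          exact (Set.encard_image_le _ _).trans (ha x)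
      _ ≤ _ := by norm_cast; omega
  · have hsub : (coupling G H v w).neighborSet (Sum.inr x) ⊆
        (Sum.inr '' H.neighborSet x) ∪ {Sum.inl v} := by
      rintro (y | y) hy <;>
        simp_all [coupling, SimpleGraph.edge_adj]
    calc _ ≤ _ := Set.encard_le_encard hsub
      _ ≤ (Sum.inr '' H.neighborSet x : Set (V ⊕ W)).encard + 1 := by
          simpa using Set.encard_union_le (Sum.inr '' H.neighborSet x : Set (V ⊕ W)) {Sum.inl v}
      _ ≤ (b : ℕ∞) + 1 := by
          gcongr
          exact (Set.encard_image_le _ _).trans (hb x)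
      _ ≤ _ := by norm_cast; omega

theorem uniformlyLocallyFinite_flowerWithRay {n : ℕ} (k : Fin n → ℕ) :
    UniformlyLocallyFinite (flowerWithRay k) :=
  uniformlyLocallyFinite_coupling (uniformlyLocallyFinite_of_finite _)
    uniformlyLocallyFinite_ray none 0

/-- The discrete spectrum of the flower with the infinite path attached to its root. -/
def flowerDiscreteSpectrum {n : ℕ} (k : Fin n → ℕ) : Set ℂ :=
  discreteSpectrum (adjacencyOperator (flowerWithRay k) (uniformlyLocallyFinite_flowerWithRay k))

end FlowerGraph

end

namespace FlowerGraph

open scoped Fin.CommRing Fin.NatCast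

/-! ### The two secular equations -/

/-! Off `[-2, 2]` one can write `l = z + z⁻¹` with `0 < |z| < 1`. Square-summability then forces an
eigenfunction to be geometric with ratio `z` along the ray, bridge included (`eigenfunction_ray`).
What remains is a problem on the finite flower with the term `z` added at the root. Pairing it with
the eigenfunction and taking imaginary parts excludes non-real `z` (`flower_eq_zero_of_im_ne_zero`),
so `z = ε e^{-t}` and `l = 2 ε cosh t` with `ε = ±1` and `t > 0`.

For such `l` the recurrence on a petal has explicit hyperbolic solutions that do not vanish after
index `0`. Hence the root value determines the whole petal, and both neighbours of the root there
carry `ε * petalTerm (ε ^ (k + 1)) k t` times that value (`petalSeq_ends`). The only equation left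
is the one at the root; since `2 cosh t - e^{-t} = e^t`, it is the secular equation of sign `ε`
(`two_cosh_mem_iff`).

Each secular equation has exactly one solution: its left side is antitone, `exp` is strictly
increasing, and the limit of the left side at `0` exceeds `1` (`existsUnique_secular`). For `ε = -1`
that limit condition fails exactly for the single triangle. -/

/-- The recurrence `sinh ((m+2)u) + sinh (mu) = 2 cosh u sinh ((m+1)u)`, read as a continued
fraction; it drives the induction for monotonicity. -/
theorem sinh_ratio_succ {u : ℝ} (hu : 0 < u) (m : ℕ) :
    Real.sinh ((m + 1 : ℕ) * u) / Real.sinh ((m + 2 : ℕ) * u) =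
      (2 * Real.cosh u - Real.sinh (m * u) / Real.sinh ((m + 1 : ℕ) * u))⁻¹ := by
  have h1 : 0 < Real.sinh ((m + 1 : ℕ) * u) := Real.sinh_pos_iff.2 (by positivity)
  have h2 : 0 < Real.sinh ((m + 2 : ℕ) * u) := Real.sinh_pos_iff.2 (by positivity)
  have h3 : 2 * Real.cosh u - Real.sinh (m * u) / Real.sinh ((m + 1 : ℕ) * u) =
      Real.sinh ((m + 2 : ℕ) * u) / Real.sinh ((m + 1 : ℕ) * u) := by
    rw [eq_div_iff h1.ne', sub_mul, div_mul_cancel₀ _ h1.ne']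
    have e1 : ((m + 2 : ℕ) : ℝ) * u = ((m + 1 : ℕ) : ℝ) * u + u := by push_cast; ring
    have e2 : (m : ℝ) * u = ((m + 1 : ℕ) : ℝ) * u - u := by push_cast; ring
    rw [e1, e2, Real.sinh_add, Real.sinh_sub]
    ring
  rw [h3, inv_div]

/-- In the continued fraction `cosh` increases and the preceding ratio decreases, so the positive
denominator increases. -/
theorem sinh_ratio_antitone (m : ℕ) :
    AntitoneOn (fun u : ℝ => Real.sinh (m * u) / Real.sinh ((m + 1 : ℕ) * u)) (Set.Ioi 0) := by
  induction m with
  | zero => intro a _ b _ _; simp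
  | succ m ih =>
    intro a ha b hb hab
    have ha' : (0 : ℝ) < a := ha
    have hb' : (0 : ℝ) < b := hb
    have h := ih ha hb hab
    simp only at h ⊢
    rw [sinh_ratio_succ ha', sinh_ratio_succ hb']
    have hc : Real.cosh a ≤ Real.cosh b := by
      rw [Real.cosh_le_cosh, abs_of_pos ha', abs_of_pos hb']; exact hab
    have hpos : 0 < 2 * Real.cosh a - Real.sinh (m * a) / Real.sinh ((m + 1 : ℕ) * a) := by
      have h1 : 0 < Real.sinh ((m + 1 : ℕ) * a) := Real.sinh_pos_iff.2 (by positivity)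
      have h2 : Real.sinh (m * a) / Real.sinh ((m + 1 : ℕ) * a) ≤ 1 := by
        rw [div_le_one h1, Real.sinh_le_sinh]; push_cast; nlinarith
      linarith [Real.one_le_cosh a]
    exact inv_anti₀ hpos (by linarith)

/-- After cross-multiplying, product-to-sum formulas reduce the claim to comparing absolute values
of two pairs of arguments of `cosh`. -/
theorem cosh_ratio_antitone {a b : ℝ} (ha : 0 ≤ a) (hab : a ≤ b) :
    AntitoneOn (fun u : ℝ => Real.cosh (a * u) / Real.cosh (b * u)) (Set.Ioi 0) := by
  intro s hs t ht hst
  have hs' : (0 : ℝ) < s := hs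
  simp only
  rw [div_le_div_iff₀ (Real.cosh_pos _) (Real.cosh_pos _)]
  have e (x y : ℝ) : 2 * (Real.cosh x * Real.cosh y) = Real.cosh (y + x) + Real.cosh (y - x) := by
    rw [Real.cosh_add, Real.cosh_sub]; ring
  have h1 : Real.cosh (b * s + a * t) ≤ Real.cosh (b * t + a * s) := by
    rw [Real.cosh_le_cosh]
    apply abs_le_abs <;> nlinarith [mul_nonneg ha hs'.le, mul_nonneg (ha.trans hab) hs'.le]
  have h2 : Real.cosh (b * s - a * t) ≤ Real.cosh (b * t - a * s) := by
    rw [Real.cosh_le_cosh]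
    apply abs_le_abs <;> nlinarith [mul_nonneg ha hs'.le, mul_nonneg (ha.trans hab) hs'.le]
  have := e (a * t) (b * s)
  have := e (a * s) (b * t)
  linarith

theorem petalTerm_eq_cosh {m : ℕ} {t : ℝ} (ht : 0 < t) :
    (Real.sinh ((m + 1 : ℕ) * t) + Real.sinh t) / Real.sinh (((m + 1 : ℕ) + 1) * t) =
      Real.cosh (m * (t / 2)) / Real.cosh ((m + 2 : ℕ) * (t / 2)) := by
  have h1 : 0 < Real.sinh ((m + 2 : ℕ) * (t / 2)) := Real.sinh_pos_iff.2 (by positivity)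
  have e1 : ((m + 1 : ℕ) : ℝ) * t = ((m + 2 : ℕ) : ℝ) * (t / 2) + m * (t / 2) := by
    push_cast; ring
  have e2 : t = ((m + 2 : ℕ) : ℝ) * (t / 2) - m * (t / 2) := by push_cast; ring
  have e3 : (((m + 1 : ℕ) : ℝ) + 1) * t = 2 * (((m + 2 : ℕ) : ℝ) * (t / 2)) := by push_cast; ring
  have e4 : Real.sinh ((m + 1 : ℕ) * t) + Real.sinh t =
      2 * Real.sinh ((m + 2 : ℕ) * (t / 2)) * Real.cosh (m * (t / 2)) := by
    rw [e1, Real.sinh_add, (congrArg Real.sinh e2).trans (Real.sinh_sub _ _)]; ring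
  rw [e4, e3, Real.sinh_two_mul]
  have := Real.cosh_pos ((m + 2 : ℕ) * (t / 2))
  field_simp

/-- Sum-to-product at half arguments gives `sinh (m t/2) / sinh ((m+2) t/2)`. It is split into two
consecutive ratios so that `sinh_ratio_antitone` applies to each factor. -/
theorem petalTerm_eq_sinh {m : ℕ} {t : ℝ} (ht : 0 < t) :
    (Real.sinh ((m + 1 : ℕ) * t) - Real.sinh t) / Real.sinh (((m + 1 : ℕ) + 1) * t) =
      (Real.sinh (m * (t / 2)) / Real.sinh ((m + 1 : ℕ) * (t / 2))) *
      (Real.sinh ((m + 1 : ℕ) * (t / 2)) / Real.sinh ((m + 1 + 1 : ℕ) * (t / 2))) := by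
  have h1 : 0 < Real.sinh ((m + 1 + 1 : ℕ) * (t / 2)) := Real.sinh_pos_iff.2 (by positivity)
  have h2 : 0 < Real.sinh ((m + 1 : ℕ) * (t / 2)) := Real.sinh_pos_iff.2 (by positivity)
  have e1 : ((m + 1 : ℕ) : ℝ) * t = ((m + 1 + 1 : ℕ) : ℝ) * (t / 2) + m * (t / 2) := by
    push_cast; ring
  have e2 : t = ((m + 1 + 1 : ℕ) : ℝ) * (t / 2) - m * (t / 2) := by push_cast; ring
  have e3 : (((m + 1 : ℕ) : ℝ) + 1) * t = 2 * (((m + 1 + 1 : ℕ) : ℝ) * (t / 2)) := by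
    push_cast; ring
  have e4 : Real.sinh ((m + 1 : ℕ) * t) - Real.sinh t =
      2 * Real.cosh ((m + 1 + 1 : ℕ) * (t / 2)) * Real.sinh (m * (t / 2)) := by
    rw [e1, Real.sinh_add, (congrArg Real.sinh e2).trans (Real.sinh_sub _ _)]; ring
  rw [e4, e3, Real.sinh_two_mul]
  have := Real.cosh_pos ((m + 1 + 1 : ℕ) * (t / 2))
  rw [div_mul_div_cancel₀ h2.ne']
  field_simp

/-- The contribution of a petal with sign `c = ±1` to the secular equation. -/
noncomputable def petalTerm (c : ℝ) (k : ℕ) (t : ℝ) : ℝ :=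
  (Real.sinh (k * t) + c * Real.sinh t) / Real.sinh ((k + 1) * t)

theorem petalTerm_antitone {c : ℝ} (hc : c = 1 ∨ c = -1) {k : ℕ} (hk : 1 ≤ k) :
    AntitoneOn (petalTerm c k) (Set.Ioi 0) := by
  obtain ⟨m, rfl⟩ := Nat.exists_eq_add_of_le' hk
  intro s hs t ht hst
  have hs' : (0 : ℝ) < s := hs
  have ht' : (0 : ℝ) < t := ht
  have hs2 : s / 2 ∈ Set.Ioi (0 : ℝ) := half_pos hs'
  have ht2 : t / 2 ∈ Set.Ioi (0 : ℝ) := half_pos ht'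
  have hst2 : s / 2 ≤ t / 2 := by linarith
  rcases hc with rfl | rfl
  · simp only [petalTerm, one_mul]
    rw [petalTerm_eq_cosh hs', petalTerm_eq_cosh ht']
    exact cosh_ratio_antitone (by positivity) (by push_cast; linarith) hs2 ht2 hst2
  · simp only [petalTerm, neg_one_mul, ← sub_eq_add_neg]
    rw [petalTerm_eq_sinh hs', petalTerm_eq_sinh ht']
    have nn (a : ℕ) : 0 ≤ Real.sinh (a * (t / 2)) := Real.sinh_nonneg_iff.2 (by positivity)
    have ns (a : ℕ) : 0 ≤ Real.sinh (a * (s / 2)) := Real.sinh_nonneg_iff.2 (by positivity)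
    exact mul_le_mul (sinh_ratio_antitone m hs2 ht2 hst2) (sinh_ratio_antitone (m + 1) hs2 ht2 hst2)
      (div_nonneg (nn _) (nn _)) (div_nonneg (ns _) (ns _))

theorem petalTerm_le_one {c : ℝ} (hc : c ≤ 1) {k : ℕ} (hk : 1 ≤ k) {t : ℝ} (ht : 0 < t) :
    petalTerm c k t ≤ 1 := by
  have h0 : 0 < Real.sinh t := Real.sinh_pos_iff.2 ht
  have hs : 0 < Real.sinh ((k + 1) * t) := Real.sinh_pos_iff.2 (by positivity)
  have h1 : petalTerm c k t ≤ petalTerm 1 k t := by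
    unfold petalTerm
    gcongr
  refine h1.trans ?_
  rw [petalTerm, div_le_one hs, add_mul, one_mul, Real.sinh_add, one_mul]
  have h2 : 0 ≤ Real.sinh (k * t) := Real.sinh_nonneg_iff.2 (by positivity)
  nlinarith [Real.one_le_cosh t, Real.one_le_cosh (k * t)]

theorem tendsto_sinh_mul_div (a : ℝ) :
    Filter.Tendsto (fun t : ℝ => Real.sinh (a * t) / t) (nhdsWithin 0 (Set.Ioi 0)) (nhds a) := by
  have h : HasDerivAt (fun t : ℝ => Real.sinh (a * t)) a 0 := by
    simpa using ((hasDerivAt_id (0 : ℝ)).const_mul a).sinh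
  have h2 := h.tendsto_slope.mono_left
    (nhdsWithin_mono (0 : ℝ) (fun x (hx : 0 < x) => hx.ne' : Set.Ioi (0 : ℝ) ⊆ {0}ᶜ))
  refine h2.congr fun t => ?_
  simp [slope_def_field]

theorem tendsto_petalTerm (c : ℝ) (k : ℕ) :
    Filter.Tendsto (petalTerm c k) (nhdsWithin 0 (Set.Ioi 0)) (nhds ((k + c) / (k + 1))) := by
  have h1 := (tendsto_sinh_mul_div (k : ℝ)).add ((tendsto_sinh_mul_div 1).const_mul c)
  have h := h1.div (tendsto_sinh_mul_div ((k : ℝ) + 1)) (by positivity)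
  rw [mul_one] at h
  refine h.congr' ?_
  filter_upwards [self_mem_nhdsWithin] with t ht
  have ht' : t ≠ 0 := (show (0 : ℝ) < t from ht).ne'
  simp only [Pi.div_apply, petalTerm, one_mul]
  rw [← mul_div_assoc, ← add_div, div_div_div_cancel_right₀ ht']

theorem continuousOn_petalTerm (c : ℝ) (k : ℕ) : ContinuousOn (petalTerm c k) (Set.Ioi 0) := by
  unfold petalTerm
  refine ContinuousOn.div (by fun_prop) (by fun_prop) fun t ht => ?_
  have ht' : (0 : ℝ) < t := ht
  exact (Real.sinh_pos_iff.2 (by positivity)).ne'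

/-- An antitone function meets the strictly increasing `exp` at most once; `h0` puts it above `exp`
near `0`, and boundedness puts it below eventually. The signs `c j` may vary from petal to petal, so
both secular equations are covered. -/
theorem existsUnique_secular {n : ℕ} {k : Fin n → ℕ} (hk : ∀ j, 1 ≤ k j) {c : Fin n → ℝ}
    (hc : ∀ j, c j = 1 ∨ c j = -1) (h0 : 1 < 2 * ∑ j, ((k j : ℝ) + c j) / (k j + 1)) :
    ∃ t₀ : ℝ, ∀ t : ℝ, (0 < t ∧ 2 * ∑ j, petalTerm (c j) (k j) t = Real.exp t) ↔ t = t₀ := by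
  set F : ℝ → ℝ := fun t => 2 * ∑ j, petalTerm (c j) (k j) t with hF
  have hanti : AntitoneOn F (Set.Ioi 0) := fun s hs t ht hst => by
    simp only [hF]
    gcongr with j
    exact petalTerm_antitone (hc j) (hk j) hs ht hst
  have hcont : ContinuousOn (fun t => F t - Real.exp t) (Set.Ioi 0) := by
    refine ContinuousOn.sub ?_ (by fun_prop)
    exact continuousOn_const.mul (continuousOn_finsetSum _ fun j _ => continuousOn_petalTerm _ _)
  have hlim : Filter.Tendsto (fun t => F t - Real.exp t) (nhdsWithin 0 (Set.Ioi 0))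
      (nhds (2 * ∑ j, ((k j : ℝ) + c j) / (k j + 1) - 1)) := by
    refine Filter.Tendsto.sub
      ((tendsto_finsetSum _ fun j _ => tendsto_petalTerm (c j) (k j)).const_mul 2) ?_
    have := (Real.continuous_exp.tendsto 0).mono_left
      (nhdsWithin_le_nhds : nhdsWithin (0 : ℝ) (Set.Ioi 0) ≤ nhds 0)
    rwa [Real.exp_zero] at this
  obtain ⟨a, hapos, ha0⟩ : ∃ a, 0 < F a - Real.exp a ∧ 0 < a :=
    ((hlim.eventually_const_lt (sub_pos.2 h0)).and self_mem_nhdsWithin).exists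
  -- Each petal term is at most `1`, so `F b ≤ 2 * n ≤ b < exp b`.
  set b : ℝ := max a (2 * n) with hb
  have hab : a ≤ b := le_max_left _ _
  have hbneg : F b - Real.exp b ≤ 0 := by
    have h1 : F b ≤ 2 * ∑ _j : Fin n, (1 : ℝ) := by
      simp only [hF]
      gcongr with j
      refine petalTerm_le_one ?_ (hk j) (ha0.trans_le hab)
      rcases hc j with h | h <;> rw [h]
      norm_num
    have h2 : (2 * n : ℝ) ≤ b := le_max_right _ _
    simp only [Finset.sum_const, Finset.card_univ, Fintype.card_fin, nsmul_eq_mul, mul_one] at h1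
    linarith [Real.add_one_le_exp b]
  obtain ⟨t₀, ht₀, heq⟩ := intermediate_value_Icc' hab
    (hcont.mono fun x hx => ha0.trans_le hx.1) ⟨hbneg, hapos.le⟩
  have hpos : 0 < t₀ := ha0.trans_le ht₀.1
  have heq' : F t₀ = Real.exp t₀ := by simpa [sub_eq_zero] using heq
  refine ⟨t₀, fun t => ⟨fun ⟨ht, h⟩ => ?_, ?_⟩⟩
  · rcases lt_trichotomy t t₀ with hlt | h' | hlt
    · have h1 := hanti (a := t) (b := t₀) ht hpos hlt.le
      have h2 := Real.exp_lt_exp.2 hlt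
      change F t = _ at h
      linarith
    · exact h'
    · have h1 := hanti (a := t₀) (b := t) hpos ht hlt.le
      have h2 := Real.exp_lt_exp.2 hlt
      change F t = _ at h
      linarith
  · rintro rfl
    exact ⟨hpos, heq'⟩

theorem one_third_le_petalTerm_limit {c : ℝ} (hc : -1 ≤ c) {k : ℕ} (hk : 2 ≤ k) :
    1 / 3 ≤ ((k : ℝ) + c) / (k + 1) := by
  have : (2 : ℝ) ≤ k := by exact_mod_cast hk
  rw [le_div_iff₀ (by positivity)]
  linarith

theorem one_lt_secular_plus {n : ℕ} (hn : 1 ≤ n) (k : Fin n → ℕ) :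
    1 < 2 * ∑ j, ((k j : ℝ) + 1) / (k j + 1) := by
  have h (j) : ((k j : ℝ) + 1) / (k j + 1) = 1 := div_self (by positivity)
  simp only [h, Finset.sum_const, Finset.card_univ, Fintype.card_fin, nsmul_eq_mul, mul_one]
  have : (1 : ℝ) ≤ n := by exact_mod_cast hn
  linarith

theorem one_lt_secular_minus {n : ℕ} (hn : 1 ≤ n) {k : Fin n → ℕ} (hk : ∀ j, 2 ≤ k j)
    (h : ¬ (n = 1 ∧ ∀ j, k j = 2)) :
    1 < 2 * ∑ j, ((k j : ℝ) + (-1) ^ (k j + 1)) / (k j + 1) := by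
  have hm (m : ℕ) : -1 ≤ (-1 : ℝ) ^ m := by
    rcases neg_one_pow_eq_or ℝ m with h | h <;> rw [h]
    norm_num
  rcases hn.eq_or_lt with rfl | hn2
  · have hk2 : k 0 ≠ 2 := fun h0 => h ⟨rfl, fun j => by rw [Subsingleton.elim j 0, h0]⟩
    have hk3 : 3 ≤ k 0 := by have := hk 0; omega
    have hk3' : (3 : ℝ) ≤ k 0 := by exact_mod_cast hk3
    rw [Fin.sum_univ_one, ← mul_div_assoc, lt_div_iff₀ (by positivity)]
    -- The sign-blind bound `2 (k - 1) / (k + 1)` is only `1` at `k = 3`. There the exponent `k + 1`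
    -- is even and the true value is `2`.
    rcases hk3.eq_or_lt with h3 | h4
    · rw [← h3]; norm_num
    · have h4' : (4 : ℝ) ≤ k 0 := by exact_mod_cast h4
      linarith [hm (k 0 + 1)]
  -- The triangle is the worst petal, contributing `1/3`; two petals already give `4/3 > 1`.
  · have h1 : ∑ _j : Fin n, (1 / 3 : ℝ) ≤ ∑ j, ((k j : ℝ) + (-1) ^ (k j + 1)) / (k j + 1) :=
      Finset.sum_le_sum fun j _ => one_third_le_petalTerm_limit (hm _) (hk j)
    simp only [Finset.sum_const, Finset.card_univ, Fintype.card_fin, nsmul_eq_mul] at h1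
    have : (2 : ℝ) ≤ n := by exact_mod_cast hn2
    linarith

/-! ### The eigenvalue equation on the flower with a ray -/

open Classical in
theorem adjFun_coupling_inl {V W : Type*} {G : SimpleGraph V} (hG : UniformlyLocallyFinite G)
    (H : SimpleGraph W) (v : V) (w : W) (f : V ⊕ W → ℂ) (x : V) :
    adjFun (coupling G H v w) f (Sum.inl x) =
      adjFun G (f ∘ Sum.inl) x + if x = v then f (Sum.inr w) else 0 := by
  have himg : ∑ᶠ y ∈ (Sum.inl '' G.neighborSet x : Set (V ⊕ W)), f y =
      adjFun G (f ∘ Sum.inl) x := finsum_mem_image Sum.inl_injective.injOn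
  by_cases hx : x = v
  · have hset : (coupling G H v w).neighborSet (Sum.inl x) =
        insert (Sum.inr w) (Sum.inl '' G.neighborSet x) := by
      ext (y | y) <;> simp [coupling, SimpleGraph.edge_adj, hx]
    rw [adjFun, hset, finsum_mem_insert _ (by simp) ((neighborSet_finite hG x).image _), himg,
      if_pos hx, add_comm]
  · have hset : (coupling G H v w).neighborSet (Sum.inl x) = Sum.inl '' G.neighborSet x := by
      ext (y | y) <;> simp [coupling, SimpleGraph.edge_adj, hx]
    rw [adjFun, hset, himg, if_neg hx, add_zero]

open Classical in
theorem adjFun_coupling_inr {V W : Type*} (G : SimpleGraph V) {H : SimpleGraph W}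
    (hH : UniformlyLocallyFinite H) (v : V) (w : W) (f : V ⊕ W → ℂ) (x : W) :
    adjFun (coupling G H v w) f (Sum.inr x) =
      adjFun H (f ∘ Sum.inr) x + if x = w then f (Sum.inl v) else 0 := by
  have himg : ∑ᶠ y ∈ (Sum.inr '' H.neighborSet x : Set (V ⊕ W)), f y =
      adjFun H (f ∘ Sum.inr) x := finsum_mem_image Sum.inr_injective.injOn
  by_cases hx : x = w
  · have hset : (coupling G H v w).neighborSet (Sum.inr x) =
        insert (Sum.inl v) (Sum.inr '' H.neighborSet x) := by
      ext (y | y) <;> simp [coupling, SimpleGraph.edge_adj, hx]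
    rw [adjFun, hset, finsum_mem_insert _ (by simp) ((neighborSet_finite hH x).image _), himg,
      if_pos hx, add_comm]
  · have hset : (coupling G H v w).neighborSet (Sum.inr x) = Sum.inr '' H.neighborSet x := by
      ext (y | y) <;> simp [coupling, SimpleGraph.edge_adj, hx]
    rw [adjFun, hset, himg, if_neg hx, add_zero]

theorem adjFun_ray_zero (f : ℕ → ℂ) : adjFun ray f 0 = f 1 := by
  have : ray.neighborSet 0 = {1} := by
    ext m
    simp only [ray, SimpleGraph.mem_neighborSet, SimpleGraph.hasse_adj,
      Nat.covBy_iff_add_one_eq, Set.mem_singleton_iff]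
    omega
  rw [adjFun, this, finsum_mem_singleton]

theorem adjFun_ray_succ (f : ℕ → ℂ) (m : ℕ) : adjFun ray f (m + 1) = f m + f (m + 2) := by
  have : ray.neighborSet (m + 1) = {m, m + 2} := by
    ext i
    simp only [ray, SimpleGraph.mem_neighborSet, SimpleGraph.hasse_adj,
      Nat.covBy_iff_add_one_eq, Set.mem_singleton_iff, Set.mem_insert_iff]
    omega
  rw [adjFun, this, finsum_mem_pair (by omega)]

theorem adjFun_cycleGraph {k : ℕ} (hk : 2 ≤ k) (g : Fin (k + 1) → ℂ) (v : Fin (k + 1)) :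
    adjFun (SimpleGraph.cycleGraph (k + 1)) g v = g (v - 1) + g (v + 1) := by
  obtain ⟨m, rfl⟩ := Nat.exists_eq_add_of_le' hk
  have hset : (SimpleGraph.cycleGraph (m + 2 + 1)).neighborSet v = {v - 1, v + 1} :=
    SimpleGraph.cycleGraph_neighborSet
  -- The two neighbours are distinct because the cycle has at least three vertices.
  have hne : v - 1 ≠ v + 1 := by
    intro h
    have h2 : (1 : Fin (m + 3)) + 1 = 0 := by
      have := congrArg (fun x => x - v + 1) h
      rw [show v - 1 - v + 1 = 0 by ring, show v + 1 - v + 1 = 1 + 1 by ring] at this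
      exact this.symm
    have := congrArg Fin.val h2
    rw [Fin.val_add] at this
    simp [Nat.mod_eq_of_lt] at this
  rw [adjFun, hset, finsum_mem_pair hne]

/-- The values of a function along the `j`-th petal, read cyclically from the root. -/
def petalSeq {n : ℕ} {k : Fin n → ℕ} (f : FlowerVertex k → ℂ) (j : Fin n) (i : ℕ) : ℂ :=
  f (petal k j (i : Fin (k j + 1)))

theorem petal_zero {n : ℕ} (k : Fin n → ℕ) (j : Fin n) : petal k j 0 = none := rfl

theorem petal_succ {n : ℕ} (k : Fin n → ℕ) (j : Fin n) (i : Fin (k j)) :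
    petal k j i.succ = some ⟨j, i⟩ := rfl

theorem petalSeq_zero {n : ℕ} {k : Fin n → ℕ} (f : FlowerVertex k → ℂ) (j : Fin n) :
    petalSeq f j 0 = f none := by
  rw [petalSeq, Nat.cast_zero, petal_zero]

theorem petalSeq_last {n : ℕ} {k : Fin n → ℕ} (f : FlowerVertex k → ℂ) (j : Fin n) :
    petalSeq f j (k j + 1) = f none := by
  rw [petalSeq, Fin.natCast_self, petal_zero]

theorem natCast_eq_succ {m : ℕ} (i : Fin m) : (((i : ℕ) + 1 : ℕ) : Fin (m + 1)) = i.succ := by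
  apply Fin.ext
  rw [Fin.val_natCast, Fin.val_succ, Nat.mod_eq_of_lt (by omega)]

theorem petalSeq_succ {n : ℕ} {k : Fin n → ℕ} (f : FlowerVertex k → ℂ) (j : Fin n)
    (i : Fin (k j)) : petalSeq f j (i + 1) = f (some ⟨j, i⟩) := by
  rw [petalSeq, natCast_eq_succ, petal_succ]

theorem adjFun_flower_some {n : ℕ} {k : Fin n → ℕ} (hk : ∀ j, 2 ≤ k j)
    (f : FlowerVertex k → ℂ) (j : Fin n) (i : Fin (k j)) :
    adjFun (flower k) f (some ⟨j, i⟩) = petalSeq f j i + petalSeq f j (i + 2) := by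
  have hset : (flower k).neighborSet (some ⟨j, i⟩) =
      petal k j '' (SimpleGraph.cycleGraph (k j + 1)).neighborSet i.succ := by
    rw [← SimpleGraph.neighborSet_map, petal_succ]
    ext w
    simp only [flower, SimpleGraph.mem_neighborSet, SimpleGraph.iSup_adj]
    refine ⟨?_, fun h => ⟨j, h⟩⟩
    rintro ⟨j', h⟩
    rw [SimpleGraph.map_adj] at h
    obtain ⟨a, b, hab, ha, hb⟩ := h
    obtain rfl : j' = j := by
      induction a using Fin.cases with
      | zero => simp [petal_zero] at ha
      | succ a =>
        rw [petal_succ] at ha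
        simp only [Option.some.injEq, Sigma.mk.injEq] at ha
        exact ha.1
    rw [SimpleGraph.map_adj]
    exact ⟨a, b, hab, ha, hb⟩
  rw [adjFun, hset, finsum_mem_image (petal k j).injective.injOn]
  have h := adjFun_cycleGraph (hk j) (fun v => f (petal k j v)) i.succ
  rw [adjFun] at h
  rw [h, petalSeq, petalSeq, ← natCast_eq_succ]
  push_cast
  congr 3 <;> ring_nf

theorem adjFun_flower_none {n : ℕ} {k : Fin n → ℕ} (hk : ∀ j, 2 ≤ k j)
    (f : FlowerVertex k → ℂ) :
    adjFun (flower k) f none = ∑ j, (petalSeq f j (k j) + petalSeq f j 1) := by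
  have hset : (flower k).neighborSet none =
      ⋃ j, petal k j '' (SimpleGraph.cycleGraph (k j + 1)).neighborSet 0 := by
    rw [flower, SimpleGraph.neighborSet_iSup]
    refine Set.iUnion_congr fun j => ?_
    rw [← SimpleGraph.neighborSet_map, petal_zero]
  have hdisj : Pairwise (Function.onFun Disjoint fun j =>
      petal k j '' (SimpleGraph.cycleGraph (k j + 1)).neighborSet 0) := by
    intro j j' hjj
    rw [Function.onFun, Set.disjoint_left]
    rintro _ ⟨a, ha, rfl⟩ ⟨b, hb, hab⟩
    induction a using Fin.cases with
    | zero => exact (SimpleGraph.irrefl _ ha).elim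
    | succ a =>
      induction b using Fin.cases with
      | zero => exact (SimpleGraph.irrefl _ hb).elim
      | succ b =>
        rw [petal_succ, petal_succ] at hab
        simp only [Option.some.injEq, Sigma.mk.injEq] at hab
        exact hjj hab.1.symm
  rw [adjFun, hset, finsum_mem_iUnion hdisj fun j => Set.toFinite _, finsum_eq_sum_of_fintype]
  refine Finset.sum_congr rfl fun j _ => ?_
  rw [finsum_mem_image (petal k j).injective.injOn]
  have h := adjFun_cycleGraph (hk j) (fun v => f (petal k j v)) 0
  rw [adjFun] at h
  have hlast : (0 : Fin (k j + 1)) - 1 = (k j : ℕ) := by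
    rw [sub_eq_iff_eq_add]
    have := Fin.natCast_self (k j + 1)
    push_cast at this
    exact this.symm
  rw [h, petalSeq, petalSeq, hlast, zero_add, Nat.cast_one]

/-- The eigenvalue equation for the flower with a ray, written out vertex by vertex. -/
theorem adjFun_flowerWithRay_eq_iff {n : ℕ} {k : Fin n → ℕ} (hk : ∀ j, 2 ≤ k j) (l : ℂ)
    (f : FlowerVertex k ⊕ ℕ → ℂ) :
    (∀ v, adjFun (flowerWithRay k) f v = l * f v) ↔
      ((∑ j, (petalSeq (f ∘ Sum.inl) j (k j) + petalSeq (f ∘ Sum.inl) j 1)) + f (Sum.inr 0) =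
        l * f (Sum.inl none)) ∧
      (∀ j, ∀ i < k j, petalSeq (f ∘ Sum.inl) j i + petalSeq (f ∘ Sum.inl) j (i + 2) =
        l * petalSeq (f ∘ Sum.inl) j (i + 1)) ∧
      f (Sum.inl none) + f (Sum.inr 1) = l * f (Sum.inr 0) ∧
      ∀ m, f (Sum.inr m) + f (Sum.inr (m + 2)) = l * f (Sum.inr (m + 1)) := by
  classical
  have hfl := uniformlyLocallyFinite_of_finite (flower k)
  constructor
  · intro h
    refine ⟨?_, fun j i hi => ?_, ?_, fun m => ?_⟩
    · have := h (Sum.inl none)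
      rwa [flowerWithRay, adjFun_coupling_inl hfl, adjFun_flower_none hk, if_pos rfl] at this
    · have := h (Sum.inl (some ⟨j, ⟨i, hi⟩⟩))
      rw [flowerWithRay, adjFun_coupling_inl hfl, adjFun_flower_some hk, if_neg (by simp),
        add_zero] at this
      rw [this]
      exact congrArg (l * ·) (petalSeq_succ (f ∘ Sum.inl) j ⟨i, hi⟩).symm
    · have := h (Sum.inr 0)
      rw [flowerWithRay, adjFun_coupling_inr _ uniformlyLocallyFinite_ray, adjFun_ray_zero,
        if_pos rfl, add_comm] at this
      exact this
    · have := h (Sum.inr (m + 1))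
      rw [flowerWithRay, adjFun_coupling_inr _ uniformlyLocallyFinite_ray, adjFun_ray_succ,
        if_neg (by simp), add_zero] at this
      exact this
  · rintro ⟨h1, h2, h3, h4⟩ ((_ | ⟨j, i⟩) | (_ | m))
    · rw [flowerWithRay, adjFun_coupling_inl hfl, adjFun_flower_none hk, if_pos rfl]
      exact h1
    · rw [flowerWithRay, adjFun_coupling_inl hfl, adjFun_flower_some hk, if_neg (by simp),
        add_zero, h2 j i i.2, petalSeq_succ]
      rfl
    · rw [flowerWithRay, adjFun_coupling_inr _ uniformlyLocallyFinite_ray, adjFun_ray_zero,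
        if_pos rfl, add_comm]
      exact h3
    · rw [flowerWithRay, adjFun_coupling_inr _ uniformlyLocallyFinite_ray, adjFun_ray_succ,
        if_neg (by simp), add_zero]
      exact h4 m

/-- The quadratic form of the adjacency matrix of a finite graph is real. -/
theorem im_sum_conj_mul_adjFun {V : Type*} [Fintype V] (G : SimpleGraph V) (x : V → ℂ) :
    (∑ v, (starRingEnd ℂ) (x v) * adjFun G x v).im = 0 := by
  classical
  have hadj (v : V) : adjFun G x v = ∑ w, if G.Adj v w then x w else 0 := by
    rw [adjFun_eq_sum (uniformlyLocallyFinite_of_finite G), ← Finset.sum_filter]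
    refine Finset.sum_congr ?_ fun _ _ => rfl
    ext w
    simp
  rw [← Complex.conj_eq_iff_im]
  simp only [hadj, Finset.mul_sum, map_sum, map_mul, Complex.conj_conj]
  rw [Finset.sum_comm]
  refine Finset.sum_congr rfl fun v _ => Finset.sum_congr rfl fun w _ => ?_
  by_cases h : G.Adj v w
  · simp [h, h.symm, mul_comm]
  · have h' : ¬ G.Adj w v := fun h' => h h'.symm
    simp [h, h']

/-! ### Solutions of the eigenvalue equation off `[-2, 2]` -/

/-- A solution is fixed by its first two values, and `u` together with its shift spans the
solutions. Multiplying by `u 1` avoids assuming it nonzero. -/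
theorem mul_eq_of_recurrence {l : ℂ} {u x : ℕ → ℂ} {k : ℕ} (hu0 : u 0 = 0)
    (hu : ∀ i, u i + u (i + 2) = l * u (i + 1))
    (hx : ∀ i < k, x i + x (i + 2) = l * x (i + 1)) :
    ∀ i ≤ k, x (i + 1) * u 1 = x 1 * u (i + 1) - x 0 * u i := by
  intro i
  induction i using Nat.strong_induction_on with
  | _ i ih =>
    intro hi
    match i with
    | 0 => rw [hu0]; ring
    | 1 =>
      have h1 := hu 0
      have h2 := hx 0 (by omega)
      simp only [zero_add] at *
      linear_combination u 1 * h2 - x 1 * h1 + x 1 * hu0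
    | i + 2 =>
      have h1 := ih i (by omega) (by omega)
      have h2 := ih (i + 1) (by omega) (by omega)
      have h3 := hx (i + 1) (by omega)
      have h4 := hu (i + 1)
      have h5 := hu i
      linear_combination u 1 * h3 - x 1 * h4 + x 0 * h5 + l * h2 - h1

theorem closed_recurrence {l : ℂ} {u x : ℕ → ℂ} {k : ℕ} (hu0 : u 0 = 0)
    (hu : ∀ i, u i + u (i + 2) = l * u (i + 1))
    (hx : ∀ i < k, x i + x (i + 2) = l * x (i + 1)) (hclosed : x (k + 1) = x 0) :
    x 1 * u (k + 1) = x 0 * (u 1 + u k) ∧ x k * u (k + 1) = x 0 * (u 1 + u k) := by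
  have h1 := mul_eq_of_recurrence hu0 hu hx k le_rfl
  -- The recurrence is invariant under reversal, so the same formula applies from the other end of
  -- the petal.
  have h2 := mul_eq_of_recurrence (x := fun i => x (k + 1 - i)) (k := k) hu0 hu (by
    intro i hi
    have := hx (k - 1 - i) (by omega)
    rw [show k - 1 - i + 2 = k + 1 - i by omega,
      show k - 1 - i + 1 = k + 1 - (i + 1) by omega] at this
    rw [show k + 1 - (i + 2) = k - 1 - i by omega, add_comm, this]) k le_rfl
  simp only [Nat.sub_self, Nat.add_sub_cancel, Nat.sub_zero] at h2
  rw [hclosed] at h1 h2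
  exact ⟨by linear_combination -h1, by linear_combination -h2⟩

/-- The solution of the recurrence with parameter `2 ε cosh t` that vanishes at `0`. -/
noncomputable def sinhSol (ε t : ℝ) (i : ℕ) : ℂ := ((ε ^ (i + 1) * Real.sinh (i * t) : ℝ) : ℂ)

theorem sinhSol_zero (ε t : ℝ) : sinhSol ε t 0 = 0 := by simp [sinhSol]

theorem sinhSol_succ_ne_zero {ε t : ℝ} (hε : ε ^ 2 = 1) (ht : 0 < t) (i : ℕ) :
    sinhSol ε t (i + 1) ≠ 0 := by
  have hε0 : ε ≠ 0 := by rintro rfl; norm_num at hε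
  have : 0 < Real.sinh ((i + 1 : ℕ) * t) := Real.sinh_pos_iff.2 (by positivity)
  rw [sinhSol, Complex.ofReal_ne_zero]
  exact mul_ne_zero (pow_ne_zero _ hε0) this.ne'

theorem sinhSol_recurrence {ε : ℝ} (hε : ε ^ 2 = 1) (t : ℝ) (i : ℕ) :
    sinhSol ε t i + sinhSol ε t (i + 2) =
      ((2 * (ε * Real.cosh t) : ℝ) : ℂ) * sinhSol ε t (i + 1) := by
  simp only [sinhSol]
  norm_cast
  have e1 : ((i + 2 : ℕ) : ℝ) * t = ((i + 1 : ℕ) : ℝ) * t + t := by push_cast; ring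
  have e2 : (i : ℝ) * t = ((i + 1 : ℕ) : ℝ) * t - t := by push_cast; ring
  rw [e1, e2, Real.sinh_add, Real.sinh_sub]
  linear_combination (-ε ^ (i + 1) * (Real.sinh ((i + 1 : ℕ) * t) * Real.cosh t -
    Real.cosh ((i + 1 : ℕ) * t) * Real.sinh t)) * hε

/-- Identifies the quotient from `closed_recurrence` with the petal term; the sign `ε ^ (k + 1)` is
the product of `ε` over the edges of the cycle. -/
theorem sinhSol_ratio {ε t : ℝ} (hε : ε ^ 2 = 1) (ht : 0 < t) (k : ℕ) :
    ((ε * petalTerm (ε ^ (k + 1)) k t : ℝ) : ℂ) * sinhSol ε t (k + 1) =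
      sinhSol ε t 1 + sinhSol ε t k := by
  simp only [sinhSol]
  norm_cast
  have hs : 0 < Real.sinh ((k + 1 : ℕ) * t) := Real.sinh_pos_iff.2 (by positivity)
  have hp : (ε ^ k) ^ 2 = 1 := by rw [← pow_mul, mul_comm, pow_mul, hε, one_pow]
  have hε4 : ε ^ 4 = 1 := by rw [show 4 = 2 * 2 by rfl, pow_mul, hε, one_pow]
  rw [petalTerm]
  push_cast at hs ⊢
  field_simp
  linear_combination (ε ^ 4 * Real.sinh t) * hp + Real.sinh t * (hε4 - hε) +
    (ε ^ (k + 1) * Real.sinh (k * t)) * hε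

theorem petalSeq_ends {n : ℕ} {k : Fin n → ℕ} {ε t : ℝ} (hε : ε ^ 2 = 1) (ht : 0 < t)
    (x : FlowerVertex k → ℂ) (j : Fin n)
    (hx : ∀ i < k j, petalSeq x j i + petalSeq x j (i + 2) =
      ((2 * (ε * Real.cosh t) : ℝ) : ℂ) * petalSeq x j (i + 1)) :
    petalSeq x j 1 = x none * (ε * petalTerm (ε ^ (k j + 1)) (k j) t : ℝ) ∧
      petalSeq x j (k j) = x none * (ε * petalTerm (ε ^ (k j + 1)) (k j) t : ℝ) := by
  have h := closed_recurrence (sinhSol_zero ε t) (sinhSol_recurrence hε t) hx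
    ((petalSeq_last x j).trans (petalSeq_zero x j).symm)
  rw [← sinhSol_ratio hε ht, petalSeq_zero, ← mul_assoc] at h
  have hne := sinhSol_succ_ne_zero hε ht (k j)
  exact ⟨mul_right_cancel₀ hne h.1, mul_right_cancel₀ hne h.2⟩

theorem petalSeq_eq_zero {n : ℕ} {k : Fin n → ℕ} {ε t : ℝ} (hε : ε ^ 2 = 1) (ht : 0 < t)
    (x : FlowerVertex k → ℂ) (hx0 : x none = 0)
    (hx : ∀ j, ∀ i < k j, petalSeq x j i + petalSeq x j (i + 2) =
      ((2 * (ε * Real.cosh t) : ℝ) : ℂ) * petalSeq x j (i + 1)) : x = 0 := by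
  funext v
  rcases v with _ | ⟨j, i⟩
  · exact hx0
  · have h := mul_eq_of_recurrence (sinhSol_zero ε t) (sinhSol_recurrence hε t) (hx j) i i.2.le
    rw [(petalSeq_ends hε ht x j (hx j)).1, petalSeq_zero, hx0, petalSeq_succ] at h
    simpa [sinhSol_succ_ne_zero hε ht 0] using h

/-- A solution of the recurrence with parameter `z + z⁻¹`, `0 < |z| < 1`, that tends to zero is
geometric. -/
theorem geometric_of_tendsto_zero {z : ℂ} (hz0 : z ≠ 0) (hz1 : ‖z‖ < 1) {y : ℕ → ℂ}
    (hy : ∀ m, y m + y (m + 2) = (z + z⁻¹) * y (m + 1))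
    (hlim : Filter.Tendsto y Filter.atTop (nhds 0)) (m : ℕ) : y m = y 0 * z ^ m := by
  -- This combination annihilates the mode `z ^ m`. What is left grows like `z⁻¹ ^ m`, yet tends to
  -- zero, so it vanishes.
  set g : ℕ → ℂ := fun m => y (m + 1) - z * y m with hg
  have hstep (m : ℕ) : g m = z * g (m + 1) := by
    simp only [hg]
    have := hy m
    field_simp at this
    linear_combination -this
  have hiter (m i : ℕ) : g m = z ^ i * g (m + i) := by
    induction i with
    | zero => simp
    | succ i ih => rw [ih, hstep, pow_succ, add_assoc]; ring
  have hglim : Filter.Tendsto g Filter.atTop (nhds 0) := by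
    simpa using (hlim.comp (Filter.tendsto_add_atTop_nat 1)).sub (hlim.const_mul z)
  have hg0 (m : ℕ) : g m = 0 := by
    have h1 : Filter.Tendsto (fun i => z ^ i * g (m + i)) Filter.atTop (nhds (0 * 0)) := by
      refine (tendsto_pow_atTop_nhds_zero_of_norm_lt_one hz1).mul ?_
      have := hglim.comp (Filter.tendsto_add_atTop_nat m)
      refine this.congr fun i => ?_
      simp [add_comm]
    have h2 : Filter.Tendsto (fun i => z ^ i * g (m + i)) Filter.atTop (nhds (g m)) :=
      tendsto_const_nhds.congr fun i => hiter m i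
    simpa using tendsto_nhds_unique h2 h1
  induction m with
  | zero => simp
  | succ m ih =>
    have := hg0 m
    simp only [hg, sub_eq_zero] at this
    rw [this, ih]; ring

theorem exists_joukowski {l : ℂ} (hl : l ∉ (fun x : ℝ => (x : ℂ)) '' Set.Icc (-2) 2) :
    ∃ z : ℂ, z ≠ 0 ∧ ‖z‖ < 1 ∧ l = z + z⁻¹ := by
  obtain ⟨s, hs⟩ := IsAlgClosed.exists_pow_nat_eq (l ^ 2 - 4) (n := 2) (by norm_num)
  -- The roots of `X² - l X + 1` have product `1`, so one lies inside the unit disc unless both are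
  -- on the circle. In that case `l = 2 Re z` would lie in `[-2, 2]`.
  set z : ℂ := (l + s) / 2 with hz
  have hmul : z * (l - z) = 1 := by rw [hz]; linear_combination -hs / 4
  have hz0 : z ≠ 0 := by rintro h; rw [h] at hmul; simp at hmul
  have hinv : z⁻¹ = l - z := inv_eq_of_mul_eq_one_right hmul
  rcases lt_trichotomy ‖z‖ 1 with h | h | h
  · exact ⟨z, hz0, h, by rw [hinv]; ring⟩
  · exfalso
    apply hl
    have hconj : z⁻¹ = (starRingEnd ℂ) z := Complex.inv_eq_conj h
    refine ⟨2 * z.re, ?_, ?_⟩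
    · have := abs_le.1 ((Complex.abs_re_le_norm z).trans h.le)
      constructor <;> linarith
    · have : l = z + (starRingEnd ℂ) z := by rw [← hconj, hinv]; ring
      rw [this, Complex.add_conj]
  · refine ⟨z⁻¹, inv_ne_zero hz0, ?_, by rw [inv_inv, hinv]; ring⟩
    rw [norm_inv]
    exact inv_lt_one_of_one_lt₀ h

/-- With `S = ∑ |x v|²`, pairing the equation with `x` gives a real quadratic form equal to `S (z +
z⁻¹) - |x(root)|² z`. Its imaginary part, divided by `Im z`, reads `S (1 - |z|⁻²) = |x(root)|²`. The
left side is nonpositive and the right nonnegative, so `S = 0`. -/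
theorem flower_eq_zero_of_im_ne_zero {n : ℕ} {k : Fin n → ℕ} {z : ℂ} (hz0 : z ≠ 0)
    (hz1 : ‖z‖ < 1) (him : z.im ≠ 0) {f : FlowerVertex k ⊕ ℕ → ℂ}
    (hf : ∀ v, adjFun (flowerWithRay k) f v = (z + z⁻¹) * f v)
    (hray : f (Sum.inr 0) = z * f (Sum.inl none)) (v : FlowerVertex k) : f (Sum.inl v) = 0 := by
  classical
  set x : FlowerVertex k → ℂ := f ∘ Sum.inl with hx
  have hv (v : FlowerVertex k) : (starRingEnd ℂ) (x v) * adjFun (flower k) x v =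
      ((Complex.normSq (x v) : ℝ) : ℂ) * (z + z⁻¹) -
        if v = none then ((Complex.normSq (x none) : ℝ) : ℂ) * z else 0 := by
    have h := hf (Sum.inl v)
    rw [flowerWithRay, adjFun_coupling_inl (uniformlyLocallyFinite_of_finite _)] at h
    change adjFun (flower k) x v + _ = _ * x v at h
    rw [← Complex.mul_conj]
    split_ifs at h ⊢ with hn
    · subst hn
      rw [hray] at h
      change _ + z * x none = _ at h
      rw [← Complex.mul_conj]
      linear_combination (starRingEnd ℂ) (x none) * h
    · linear_combination (starRingEnd ℂ) (x v) * h
  have hsum := im_sum_conj_mul_adjFun (flower k) x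
  simp only [hv, Finset.sum_sub_distrib, ← Finset.sum_mul, Finset.sum_ite_eq', Finset.mem_univ,
    if_true, ← Complex.ofReal_sum, Complex.sub_im, Complex.im_ofReal_mul, Complex.add_im,
    Complex.inv_im] at hsum
  have hN : 0 < Complex.normSq z := Complex.normSq_pos.2 hz0
  have hN1 : Complex.normSq z < 1 := by
    rw [Complex.normSq_eq_norm_sq]
    nlinarith [norm_nonneg z]
  have hfac : (∑ v, Complex.normSq (x v)) * (1 - (Complex.normSq z)⁻¹) -
      Complex.normSq (x none) = 0 := by
    apply mul_right_cancel₀ him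
    rw [zero_mul, ← hsum]
    ring
  have hinv : 1 - (Complex.normSq z)⁻¹ < 0 := by
    have := (one_lt_inv₀ hN).2 hN1
    linarith
  have hnn (v) : 0 ≤ Complex.normSq (x v) := Complex.normSq_nonneg _
  have hS : ∑ v, Complex.normSq (x v) = 0 := by
    have h0 : 0 ≤ ∑ v, Complex.normSq (x v) := Finset.sum_nonneg fun v _ => hnn v
    nlinarith [hnn none]
  have := (Finset.sum_eq_zero_iff_of_nonneg fun v _ => hnn v).1 hS v (Finset.mem_univ v)
  exact Complex.normSq_eq_zero.1 this

/-! ### Square-summable eigenfunctions and the secular equation. -/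

theorem mem_eigenspace_adjacencyOperator_iff {V : Type*} {G : SimpleGraph V}
    (hG : UniformlyLocallyFinite G) (l : ℂ) (f : EllTwo V) :
    f ∈ Module.End.eigenspace (adjacencyOperator G hG : EllTwo V →ₗ[ℂ] EllTwo V) l ↔
      ∀ v, adjFun G f v = l * f v := by
  rw [Module.End.mem_eigenspace_iff]
  constructor
  · intro h v
    exact congrArg (fun g : EllTwo V => g v) h
  · intro h
    ext v
    exact h v

theorem tendsto_ray {V : Type*} (f : EllTwo (V ⊕ ℕ)) :
    Filter.Tendsto (fun m => f (Sum.inr m)) Filter.atTop (nhds 0) := by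
  have h := (lp.memℓp f).summable (by simp)
  have h2 := (h.comp_injective (Sum.inr_injective (α := V) (β := ℕ))).tendsto_atTop_zero
  simp only [Function.comp_def, ENNReal.toReal_ofNat, Real.rpow_ofNat] at h2
  rw [tendsto_zero_iff_norm_tendsto_zero]
  have h3 := (Real.continuous_sqrt.tendsto 0).comp h2
  simpa [Function.comp_def, Real.sqrt_sq] using h3

theorem eigenfunction_ray {n : ℕ} {k : Fin n → ℕ} (hk : ∀ j, 2 ≤ k j) {z : ℂ} (hz0 : z ≠ 0)
    (hz1 : ‖z‖ < 1) (f : EllTwo (FlowerVertex k ⊕ ℕ))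
    (hf : ∀ v, adjFun (flowerWithRay k) f v = (z + z⁻¹) * f v) (m : ℕ) :
    f (Sum.inr m) = f (Sum.inl none) * z ^ (m + 1) := by
  obtain ⟨-, -, h3, h4⟩ := (adjFun_flowerWithRay_eq_iff hk _ _).1 hf
  -- The root is prepended to the ray, so that the equation at the first ray vertex becomes one more
  -- instance of the recurrence.
  set y : ℕ → ℂ := fun m => Nat.casesOn m (f (Sum.inl none)) fun i => f (Sum.inr i) with hy
  have hlim : Filter.Tendsto y Filter.atTop (nhds 0) :=
    (Filter.tendsto_add_atTop_iff_nat 1).1 (tendsto_ray f)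
  have hrec (m : ℕ) : y m + y (m + 2) = (z + z⁻¹) * y (m + 1) := by
    cases m with
    | zero => exact h3
    | succ m => exact h4 m
  exact geometric_of_tendsto_zero hz0 hz1 hrec hlim (m + 1)

theorem exp_sign {ε t : ℝ} (hε : ε ^ 2 = 1) (ht : 0 < t) :
    ((ε * Real.exp (-t) : ℝ) : ℂ) ≠ 0 ∧ ‖((ε * Real.exp (-t) : ℝ) : ℂ)‖ < 1 ∧
      ((2 * (ε * Real.cosh t) : ℝ) : ℂ) =
        ((ε * Real.exp (-t) : ℝ) : ℂ) + ((ε * Real.exp (-t) : ℝ) : ℂ)⁻¹ := by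
  have hε0 : ε ≠ 0 := by rintro rfl; norm_num at hε
  have habs : |ε| = 1 := by rw [← sq_eq_sq₀ (abs_nonneg _) zero_le_one, sq_abs, hε, one_pow]
  have hinv : ε⁻¹ = ε := inv_eq_of_mul_eq_one_left (by rw [← sq, hε])
  refine ⟨Complex.ofReal_ne_zero.2 (mul_ne_zero hε0 (Real.exp_ne_zero _)), ?_, ?_⟩
  · rw [Complex.norm_real, Real.norm_eq_abs, abs_mul, habs, one_mul, abs_of_pos (Real.exp_pos _)]
    exact Real.exp_zero ▸ Real.exp_lt_exp.2 (by linarith)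
  · rw [← Complex.ofReal_inv, ← Complex.ofReal_add, mul_inv, hinv, ← Real.exp_neg, neg_neg,
      Real.cosh_eq]
    congr 1
    ring

theorem two_cosh_notMem {ε t : ℝ} (hε : ε ^ 2 = 1) (ht : 0 < t) :
    ((2 * (ε * Real.cosh t) : ℝ) : ℂ) ∉ (fun x : ℝ => (x : ℂ)) '' Set.Icc (-2) 2 := by
  rintro ⟨x, ⟨h1, h2⟩, hx⟩
  have hx' : x = 2 * (ε * Real.cosh t) := Complex.ofReal_injective hx
  have hc := Real.one_lt_cosh.2 ht.ne'
  rcases (sq_eq_sq_iff_eq_or_eq_neg.1 (hε.trans (one_pow 2).symm)) with rfl | rfl <;> linarith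

/-- The root value determines every petal and the ray. This yields both the division by the root
value in the secular equation and the finite multiplicity. -/
theorem eigenfunction_eq_zero {n : ℕ} {k : Fin n → ℕ} (hk : ∀ j, 2 ≤ k j) {ε t : ℝ}
    (hε : ε ^ 2 = 1) (ht : 0 < t) (f : EllTwo (FlowerVertex k ⊕ ℕ))
    (hf : ∀ v, adjFun (flowerWithRay k) f v = ((2 * (ε * Real.cosh t) : ℝ) : ℂ) * f v)
    (h0 : f (Sum.inl none) = 0) : f = 0 := by
  obtain ⟨-, h2, -, -⟩ := (adjFun_flowerWithRay_eq_iff hk _ _).1 hf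
  obtain ⟨hz0, hz1, hl⟩ := exp_sign hε ht
  rw [hl] at hf
  have hx := petalSeq_eq_zero hε ht (f ∘ Sum.inl) h0 h2
  ext (v | m)
  · exact congrFun hx v
  · rw [eigenfunction_ray hk hz0 hz1 f hf, h0, zero_mul]
    rfl

/-- The root equation, once the petals and the ray are solved, is the secular equation. -/
theorem root_equation_iff {n : ℕ} {k : Fin n → ℕ} {ε t : ℝ} (hε : ε ^ 2 = 1) (ht : 0 < t)
    {f : FlowerVertex k ⊕ ℕ → ℂ} (h0 : f (Sum.inl none) ≠ 0)
    (hpetal : ∀ j, ∀ i < k j, petalSeq (f ∘ Sum.inl) j i + petalSeq (f ∘ Sum.inl) j (i + 2) =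
      ((2 * (ε * Real.cosh t) : ℝ) : ℂ) * petalSeq (f ∘ Sum.inl) j (i + 1))
    (hray : f (Sum.inr 0) = f (Sum.inl none) * ((ε * Real.exp (-t) : ℝ) : ℂ)) :
    (∑ j, (petalSeq (f ∘ Sum.inl) j (k j) + petalSeq (f ∘ Sum.inl) j 1)) + f (Sum.inr 0) =
        ((2 * (ε * Real.cosh t) : ℝ) : ℂ) * f (Sum.inl none) ↔
      2 * ∑ j, petalTerm (ε ^ (k j + 1)) (k j) t = Real.exp t := by
  have hε0 : ε ≠ 0 := by rintro rfl; norm_num at hε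
  have hends (j : Fin n) : petalSeq (f ∘ Sum.inl) j (k j) + petalSeq (f ∘ Sum.inl) j 1 =
      f (Sum.inl none) * ((2 * (ε * petalTerm (ε ^ (k j + 1)) (k j) t) : ℝ) : ℂ) := by
    obtain ⟨h1, h2⟩ := petalSeq_ends hε ht (f ∘ Sum.inl) j (hpetal j)
    rw [h1, h2, Function.comp_apply]
    push_cast
    ring
  simp only [hends, hray]
  rw [← Finset.mul_sum, ← mul_add, mul_comm _ (f (Sum.inl none)), mul_right_inj' h0,
    ← Complex.ofReal_sum, ← Complex.ofReal_add, Complex.ofReal_inj, ← Finset.mul_sum,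
    ← Finset.mul_sum, Real.cosh_eq]
  constructor
  · intro h
    apply mul_left_cancel₀ hε0
    linear_combination h
  · intro h
    linear_combination ε * h

/-- The eigenfunction of the flower with a ray, normalized to be `1` at the root. -/
noncomputable def eigenFun {n : ℕ} (k : Fin n → ℕ) (ε t : ℝ) : FlowerVertex k ⊕ ℕ → ℂ
  | Sum.inl none => 1
  | Sum.inl (some ⟨j, i⟩) =>
    (sinhSol ε t (k j - i) + sinhSol ε t (i + 1)) / sinhSol ε t (k j + 1)
  | Sum.inr m => ((ε * Real.exp (-t) : ℝ) : ℂ) ^ (m + 1)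

/-- The formula is symmetric under reversal and equals `1` at indices `0` and `k j + 1`, both of
which are the root; this lets the recurrence be checked uniformly. -/
theorem petalSeq_eigenFun {n : ℕ} (k : Fin n → ℕ) {ε t : ℝ} (hε : ε ^ 2 = 1) (ht : 0 < t)
    (j : Fin n) {i : ℕ} (hi : i ≤ k j + 1) :
    petalSeq (eigenFun k ε t ∘ Sum.inl) j i =
      (sinhSol ε t (k j + 1 - i) + sinhSol ε t i) / sinhSol ε t (k j + 1) := by
  have hne := sinhSol_succ_ne_zero hε ht (k j)
  rcases hi.eq_or_lt with rfl | hlt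
  · rw [petalSeq_last, Nat.sub_self, sinhSol_zero, zero_add, div_self hne]
    rfl
  · cases i with
    | zero =>
      rw [petalSeq_zero, Nat.sub_zero, sinhSol_zero, add_zero, div_self hne]
      rfl
    | succ i =>
      have := petalSeq_succ (eigenFun k ε t ∘ Sum.inl) j ⟨i, by omega⟩
      rw [show k j + 1 - (i + 1) = k j - i by omega]
      exact this

theorem eigenFun_petal_recurrence {n : ℕ} (k : Fin n → ℕ) {ε t : ℝ} (hε : ε ^ 2 = 1) (ht : 0 < t)
    (j : Fin n) (i : ℕ) (hi : i < k j) :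
    petalSeq (eigenFun k ε t ∘ Sum.inl) j i + petalSeq (eigenFun k ε t ∘ Sum.inl) j (i + 2) =
      ((2 * (ε * Real.cosh t) : ℝ) : ℂ) * petalSeq (eigenFun k ε t ∘ Sum.inl) j (i + 1) := by
  rw [petalSeq_eigenFun k hε ht j (by omega), petalSeq_eigenFun k hε ht j (by omega),
    petalSeq_eigenFun k hε ht j (by omega)]
  have h1 := sinhSol_recurrence hε t (k j - 1 - i)
  have h2 := sinhSol_recurrence hε t i
  rw [show k j - 1 - i + 2 = k j + 1 - i by omega,
    show k j - 1 - i + 1 = k j + 1 - (i + 1) by omega] at h1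
  rw [show k j + 1 - (i + 2) = k j - 1 - i by omega, ← add_div, ← mul_div_assoc]
  congr 1
  linear_combination h1 + h2

theorem memℓp_eigenFun {n : ℕ} (k : Fin n → ℕ) {ε t : ℝ} (hε : ε ^ 2 = 1) (ht : 0 < t) :
    Memℓp (eigenFun k ε t) 2 := by
  obtain ⟨-, hz1, -⟩ := exp_sign hε ht
  refine memℓp_gen ?_
  simp only [ENNReal.toReal_ofNat, Real.rpow_ofNat]
  refine (HasSum.sum (f := fun v => ‖eigenFun k ε t v‖ ^ 2)
    (Summable.of_finite).hasSum (Summable.hasSum ?_)).summable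
  have hgeo : Summable fun m : ℕ => (‖((ε * Real.exp (-t) : ℝ) : ℂ)‖ ^ 2) ^ m :=
    summable_geometric_of_lt_one (by positivity) (pow_lt_one₀ (norm_nonneg _) hz1 two_ne_zero)
  refine ((summable_nat_add_iff 1).2 hgeo).congr fun m => ?_
  simp only [Function.comp_apply, eigenFun, norm_pow]
  ring

theorem two_cosh_mem_iff {n : ℕ} {k : Fin n → ℕ} (hk : ∀ j, 2 ≤ k j) {ε t : ℝ}
    (hε : ε ^ 2 = 1) (ht : 0 < t) :
    ((2 * (ε * Real.cosh t) : ℝ) : ℂ) ∈ flowerDiscreteSpectrum k ↔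
      2 * ∑ j, petalTerm (ε ^ (k j + 1)) (k j) t = Real.exp t := by
  obtain ⟨hz0, hz1, hl⟩ := exp_sign hε ht
  constructor
  · rintro ⟨hev, -, -⟩
    obtain ⟨f, hf, hfne⟩ := hev.exists_hasEigenvector
    rw [mem_eigenspace_adjacencyOperator_iff] at hf
    obtain ⟨h1, h2, -, -⟩ := (adjFun_flowerWithRay_eq_iff hk _ _).1 hf
    have h0 : f (Sum.inl none) ≠ 0 := fun h0 => hfne (eigenfunction_eq_zero hk hε ht f hf h0)
    refine (root_equation_iff hε ht h0 h2 ?_).1 h1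
    rw [hl] at hf
    simpa using eigenfunction_ray hk hz0 hz1 f hf 0
  · intro h
    set g : EllTwo (FlowerVertex k ⊕ ℕ) := ⟨eigenFun k ε t, memℓp_eigenFun k hε ht⟩ with hg
    have hg0 : g (Sum.inl none) = 1 := rfl
    have hpetal := eigenFun_petal_recurrence k hε ht
    refine ⟨?_, ?_, two_cosh_notMem hε ht⟩
    · refine Module.End.hasEigenvalue_of_hasEigenvector (x := g) ⟨?_, ?_⟩
      · rw [mem_eigenspace_adjacencyOperator_iff, adjFun_flowerWithRay_eq_iff hk]
        refine ⟨(root_equation_iff hε ht (one_ne_zero (α := ℂ)) hpetal ?_).2 h,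
          hpetal, ?_, fun m => ?_⟩
        · change ((ε * Real.exp (-t) : ℝ) : ℂ) ^ (0 + 1) = 1 * _
          rw [zero_add, pow_one, one_mul]
        · rw [hl]
          change 1 + ((ε * Real.exp (-t) : ℝ) : ℂ) ^ (1 + 1) =
            _ * ((ε * Real.exp (-t) : ℝ) : ℂ) ^ (0 + 1)
          field_simp
          ring
        · rw [hl]
          change ((ε * Real.exp (-t) : ℝ) : ℂ) ^ (m + 1) +
            ((ε * Real.exp (-t) : ℝ) : ℂ) ^ (m + 2 + 1) = _ * ((ε * Real.exp (-t) : ℝ) : ℂ) ^ (m + 1 + 1)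
          field_simp
          ring
      · intro h0
        rw [h0] at hg0
        exact zero_ne_one hg0
    -- Evaluation at the root is injective on the eigenspace, so its dimension is at most one.
    · refine FiniteDimensional.of_injective
        ({ toFun := fun f => f.1 (Sum.inl none), map_add' := fun _ _ => rfl,
           map_smul' := fun _ _ => rfl } : _ →ₗ[ℂ] ℂ) ?_
      rw [← LinearMap.ker_eq_bot, LinearMap.ker_eq_bot']
      rintro ⟨f, hf⟩ h0
      rw [mem_eigenspace_adjacencyOperator_iff] at hf
      exact Subtype.ext (eigenfunction_eq_zero hk hε ht f hf h0)

/-- A nonzero eigenfunction forces `z` to be real; then `ε` is its sign and `t = -log |z|`. -/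
theorem exists_cosh_of_mem {n : ℕ} {k : Fin n → ℕ} (hk : ∀ j, 2 ≤ k j) {l : ℂ}
    (hl : l ∈ flowerDiscreteSpectrum k) :
    ∃ ε t : ℝ, (ε = 1 ∨ ε = -1) ∧ 0 < t ∧ l = ((2 * (ε * Real.cosh t) : ℝ) : ℂ) := by
  obtain ⟨hev, -, hnot⟩ := hl
  obtain ⟨z, hz0, hz1, rfl⟩ := exists_joukowski hnot
  obtain ⟨f, hf, hfne⟩ := hev.exists_hasEigenvector
  rw [mem_eigenspace_adjacencyOperator_iff] at hf
  have hray := eigenfunction_ray hk hz0 hz1 f hf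
  have him : z.im = 0 := by
    by_contra him
    have hz := flower_eq_zero_of_im_ne_zero hz0 hz1 him hf (by rw [hray]; ring)
    apply hfne
    ext (v | m)
    · exact hz v
    · rw [hray, hz none, zero_mul]
      rfl
  obtain ⟨r, rfl⟩ : ∃ r : ℝ, z = r := ⟨z.re, Complex.ext rfl (by simpa using him)⟩
  have hr0 : r ≠ 0 := by exact_mod_cast hz0
  have hr1 : |r| < 1 := by simpa using hz1
  have habs : 0 < |r| := abs_pos.2 hr0
  have key (ε : ℝ) (hε : ε = 1 ∨ ε = -1) (hr : r = ε * |r|) :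
      ∃ ε t : ℝ, (ε = 1 ∨ ε = -1) ∧ 0 < t ∧
        (r : ℂ) + (r : ℂ)⁻¹ = ((2 * (ε * Real.cosh t) : ℝ) : ℂ) := by
    have ht : 0 < -Real.log |r| := neg_pos.2 (Real.log_neg habs hr1)
    refine ⟨ε, -Real.log |r|, hε, ht, ?_⟩
    rw [(exp_sign (by rcases hε with rfl | rfl <;> norm_num) ht).2.2, neg_neg, Real.exp_log habs,
      ← hr]
  rcases abs_choice r with h | h
  · exact key 1 (Or.inl rfl) (by rw [h, one_mul])
  · exact key (-1) (Or.inr rfl) (by rw [h]; ring)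

end FlowerGraph

/-! ### The full discrete spectrum from the two signs. -/

theorem mainTheorem3 (n : ℕ) (hn : 1 ≤ n) (k : Fin n → ℕ) (hk : ∀ j, 2 ≤ k j) :
    ∃ tp : ℝ,
      (∀ t : ℝ, (0 < t ∧
          2 * ∑ j, (Real.sinh (k j * t) + Real.sinh t) / Real.sinh ((k j + 1) * t) = Real.exp t)
        ↔ t = tp) ∧
      ((2 * Real.cosh tp : ℝ) : ℂ) ∈ FlowerGraph.flowerDiscreteSpectrum k ∧
      (¬ (n = 1 ∧ ∀ j, k j = 2) →
        ∃ tm : ℝ,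
          (∀ t : ℝ, (0 < t ∧
              2 * ∑ j, (Real.sinh (k j * t) + (-1) ^ (k j + 1) * Real.sinh t) /
                Real.sinh ((k j + 1) * t) = Real.exp t)
            ↔ t = tm) ∧
          FlowerGraph.flowerDiscreteSpectrum k =
            {((2 * Real.cosh tp : ℝ) : ℂ), ((-(2 * Real.cosh tm) : ℝ) : ℂ)}) := by
  have hk1 (j : Fin n) : 1 ≤ k j := one_le_two.trans (hk j)
  obtain ⟨tp, htp⟩ := FlowerGraph.existsUnique_secular hk1 (c := fun _ => 1)
    (fun _ => Or.inl rfl) (FlowerGraph.one_lt_secular_plus hn k)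
  obtain ⟨htp0, htpe⟩ := (htp tp).2 rfl
  have hplus {t : ℝ} (ht : 0 < t) : ((2 * Real.cosh t : ℝ) : ℂ) ∈
      FlowerGraph.flowerDiscreteSpectrum k ↔
        2 * ∑ j, FlowerGraph.petalTerm 1 (k j) t = Real.exp t := by
    simpa only [one_pow, one_mul] using
      FlowerGraph.two_cosh_mem_iff hk (ε := 1) (one_pow 2) ht
  have hminus {t : ℝ} (ht : 0 < t) : ((-(2 * Real.cosh t) : ℝ) : ℂ) ∈
      FlowerGraph.flowerDiscreteSpectrum k ↔
        2 * ∑ j, FlowerGraph.petalTerm ((-1) ^ (k j + 1)) (k j) t = Real.exp t := by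
    rw [← FlowerGraph.two_cosh_mem_iff hk (ε := -1) (by norm_num) ht, neg_one_mul, mul_neg]
  refine ⟨tp, ?_, (hplus htp0).2 htpe, fun hne => ?_⟩
  · simpa only [FlowerGraph.petalTerm, one_mul] using htp
  obtain ⟨tm, htm⟩ := FlowerGraph.existsUnique_secular hk1 (c := fun j => (-1) ^ (k j + 1))
    (fun _ => neg_one_pow_eq_or ℝ _) (FlowerGraph.one_lt_secular_minus hn hk hne)
  obtain ⟨htm0, htme⟩ := (htm tm).2 rfl
  refine ⟨tm, htm, Set.Subset.antisymm (fun l hl => ?_) ?_⟩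
  · obtain ⟨ε, t, rfl | rfl, ht, rfl⟩ := FlowerGraph.exists_cosh_of_mem hk hl
    · rw [one_mul] at hl ⊢
      rw [(htp t).1 ⟨ht, (hplus ht).1 hl⟩]
      exact Or.inl rfl
    · rw [neg_one_mul, mul_neg] at hl ⊢
      rw [(htm t).1 ⟨ht, (hminus ht).1 hl⟩]
      exact Or.inr rfl
  · rintro l (rfl | rfl)
    · exact (hplus htp0).2 htpe
    · exact (hminus htm0).2 htme
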